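/- Let $\mathbb K\in\{\mathbb R,\mathbb C\}$, let $A$ be a (not necessarily unital) Banach algebra over $\mathbb K$ with a bounded approximate left identity, let $G$ be a locally compact Hausdorff group with a fixed left Haar measure, and let $\alpha$ be a strongly continuous homomorphism from $G$ into the group of bounded algebra automorphisms of $A$. A continuous covariant representation $(\pi,U)$ of $(A,G,\alpha)$ on a Banach space $X$ consists of a norm-bounded algebra representation $\pi:A\to B(X)$ and a strongly continuous group representation $U:G\to B(X)$ such that $\pi(\alpha_s(a))=U_s\pi(a)U_s^{-1}$ for all $a\in A$, $s\in G$; it is non-degenerate if the linear span of $\pi(A)X$ is dense in $X$. Let $\mathcal R$ be a non-empty uniformly bounded class of non-degenerate continuous covariant representations, i.e. there are a constant $C\ge 0$ and a function $\nu:G\to[0,\infty)$, bounded on compact sets, such that $\|\pi\|\le C$ and $\|U_r\|\le\nu(r)$ for all $(\pi,U)\in\mathcal R$ and $r\in G$. Equip $C_c(G,A)$ with the twisted convolution $[f*g](s)=\int_G f(r)\,\alpha_r(g(r^{-1}s))\,dr$ and with the algebra seminorm $$\sigma^{\mathcal R}(f)=\sup_{(\pi,U)\in\mathcal R}\|\pi\rtimes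 U(f)\|,\qquad \pi\rtimes U(f)x=\int_G\pi(f(s))U_sx\,ds\quad(x\in X),$$ and let the crossed product $(A\rtimes_\alpha G)^{\mathcal R}$ be the Banach algebra obtained as the completion of $C_c(G,A)/\ker\sigma^{\mathcal R}$. For a Banach algebra $B$, let $\mathcal M_l(B)$ be its left centralizer algebra, i.e. the algebra of all bounded linear operators $L:B\to B$ with $L(ab)=(La)b$ for all $a,b\in B$, with the operator norm. Then the left regular representation $$\lambda:(A\rtimes_\alpha G)^{\mathcal R}\to\mathcal M_l\big((A\rtimes_\alpha G)^{\mathcal R}\big),\qquad \lambda(a)b=ab,$$ is a topological embedding, i.e. a homeomorphism onto its image. (No bounded approximate right identity is assumed to exist in $A$ or in $(A\rtimes_\alpha G)^{\mathcal R}$.) -/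

import Mathlib

open MeasureTheory Filter Topology Set
open scoped CompactlySupported

set_option linter.unusedSectionVars false

noncomputable section

namespace BanachCrossedProduct

/-! ### Integration of continuous compactly supported functions -/

section Integral

variable (𝕜 : Type*) [RCLike 𝕜] {G : Type*} [TopologicalSpace G] [MeasurableSpace G]
  {E : Type*} [NormedAddCommGroup E] [NormedSpace 𝕜 E]
  {F : Type*} [NormedAddCommGroup F] [NormedSpace 𝕜 F]

/-- The (Bochner) integral of a function with values in a normed space over `𝕜 = ℝ` or `𝕜 = ℂ`,
the real structure being the restriction of the given `𝕜`-structure. -/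
def integralK (μ : Measure G) (f : G → E) : E :=
  letI : NormedSpace ℝ E := NormedSpace.restrictScalars ℝ 𝕜 E
  ∫ s, f s ∂μ

variable {𝕜} [OpensMeasurableSpace G] {μ : Measure G} [IsFiniteMeasureOnCompacts μ]

theorem integralK_add {f g : G → E} (hf : Continuous f) (hf' : HasCompactSupport f)
    (hg : Continuous g) (hg' : HasCompactSupport g) :
    integralK 𝕜 μ (fun s => f s + g s) = integralK 𝕜 μ f + integralK 𝕜 μ g := by
  let _ : NormedSpace ℝ E := NormedSpace.restrictScalars ℝ 𝕜 E
  exact integral_add (hf.integrable_of_hasCompactSupport hf')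
    (hg.integrable_of_hasCompactSupport hg')

theorem integralK_smul (c : 𝕜) (f : G → E) :
    integralK 𝕜 μ (fun s => c • f s) = c • integralK 𝕜 μ f := by
  let _ : NormedSpace ℝ E := NormedSpace.restrictScalars ℝ 𝕜 E
  have : IsScalarTower ℝ 𝕜 E := RestrictScalars.isScalarTower ℝ 𝕜 E
  have : SMulCommClass ℝ 𝕜 E := IsScalarTower.to_smulCommClass
  exact integral_smul c f

theorem integralK_clm [CompleteSpace E] [CompleteSpace F] (L : E →L[𝕜] F) {f : G → E}
    (hf : Continuous f) (hf' : HasCompactSupport f) :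
    integralK 𝕜 μ (fun s => L (f s)) = L (integralK 𝕜 μ f) := by
  let _ : NormedSpace ℝ E := NormedSpace.restrictScalars ℝ 𝕜 E
  let _ : NormedSpace ℝ F := NormedSpace.restrictScalars ℝ 𝕜 F
  have : IsScalarTower ℝ 𝕜 E := RestrictScalars.isScalarTower ℝ 𝕜 E
  have : IsScalarTower ℝ 𝕜 F := RestrictScalars.isScalarTower ℝ 𝕜 F
  exact L.integral_comp_comm (hf.integrable_of_hasCompactSupport hf')

theorem norm_integralK_le {f : G → E} {b : G → ℝ} (hb : Continuous b) (hb' : HasCompactSupport b)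
    (h : ∀ s, ‖f s‖ ≤ b s) : ‖integralK 𝕜 μ f‖ ≤ ∫ s, b s ∂μ := by
  let _ : NormedSpace ℝ E := NormedSpace.restrictScalars ℝ 𝕜 E
  exact norm_integral_le_of_norm_le (hb.integrable_of_hasCompactSupport hb')
    (Eventually.of_forall h)

theorem integralK_swap {f : G → G → E} (hf : Continuous f.uncurry)
    (hf' : HasCompactSupport f.uncurry) :
    integralK 𝕜 μ (fun x => integralK 𝕜 μ (fun y => f x y)) =
      integralK 𝕜 μ (fun y => integralK 𝕜 μ (fun x => f x y)) := by
  let _ : NormedSpace ℝ E := NormedSpace.restrictScalars ℝ 𝕜 E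
  exact integral_integral_swap_of_hasCompactSupport hf hf'

theorem continuous_integralK {f : G → G → E} {k : Set G} (hk : IsCompact k)
    (hf : Continuous f.uncurry) (hfs : ∀ x y, y ∉ k → f x y = 0) :
    Continuous fun x => integralK 𝕜 μ (fun y => f x y) := by
  let _ : NormedSpace ℝ E := NormedSpace.restrictScalars ℝ 𝕜 E
  rw [← continuousOn_univ]
  exact continuousOn_integral_of_compact_support hk hf.continuousOn (fun x y _ hy => hfs x y hy)

theorem integralK_mul_left [Group G] [MeasurableMul G] [μ.IsMulLeftInvariant]
    (f : G → E) (r : G) : integralK 𝕜 μ (fun s => f (r * s)) = integralK 𝕜 μ f := by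
  let _ : NormedSpace ℝ E := NormedSpace.restrictScalars ℝ 𝕜 E
  exact integral_mul_left_eq_self f r

end Integral

/-! ### Strongly continuous families of operators -/

section StronglyContinuous

variable {𝕜 : Type*} [RCLike 𝕜] {G : Type*} [TopologicalSpace G]
  {E : Type*} [NormedAddCommGroup E] [NormedSpace 𝕜 E] [CompleteSpace E]

theorem exists_norm_le_on_compact {U : G → E →L[𝕜] E} (hU : ∀ x, Continuous fun s => U s x)
    {K : Set G} (hK : IsCompact K) : ∃ M : ℝ, ∀ s ∈ K, ‖U s‖ ≤ M := by
  obtain ⟨M, hM⟩ := banach_steinhaus (g := fun s : K => U s) (fun x => by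
    obtain ⟨C, hC⟩ := hK.exists_bound_of_continuousOn (hU x).continuousOn
    exact ⟨C, fun s => hC s s.2⟩)
  exact ⟨M, fun s hs => hM ⟨s, hs⟩⟩

theorem continuous_uncurry_of_strong [LocallyCompactSpace G] {U : G → E →L[𝕜] E}
    (hU : ∀ x, Continuous fun s => U s x) : Continuous fun p : G × E => U p.1 p.2 := by
  rw [continuous_iff_continuousAt]
  rintro ⟨s₀, x₀⟩
  obtain ⟨K, hK, hs₀⟩ := exists_compact_mem_nhds s₀
  obtain ⟨M, hM⟩ := exists_norm_le_on_compact hU hK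
  have h1 : Tendsto (fun p : G × E => M * ‖p.2 - x₀‖ + ‖U p.1 x₀ - U s₀ x₀‖)
      (𝓝 (s₀, x₀)) (𝓝 0) := by
    have : Continuous fun p : G × E => M * ‖p.2 - x₀‖ + ‖U p.1 x₀ - U s₀ x₀‖ := by
      have := (hU x₀).comp (continuous_fst (X := G) (Y := E))
      simp only [Function.comp_def] at this
      fun_prop
    simpa using this.tendsto (s₀, x₀)
  refine tendsto_iff_norm_sub_tendsto_zero.2 (squeeze_zero' (Eventually.of_forall fun _ =>
    norm_nonneg _) ?_ h1)
  filter_upwards [prod_mem_nhds hs₀ univ_mem] with p hp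
  have : U p.1 p.2 - U s₀ x₀ = U p.1 (p.2 - x₀) + (U p.1 x₀ - U s₀ x₀) := by
    rw [map_sub]; abel
  simp only [this]
  refine (norm_add_le _ _).trans ?_
  gcongr
  exact (U p.1).le_of_opNorm_le (hM _ hp.1) _

end StronglyContinuous

/-! ### Banach algebra dynamical systems and covariant representations -/

/-- A Banach algebra dynamical system `(A, G, α)`: a group homomorphism from `G` to the bounded
algebra automorphisms of `A` that is strongly continuous. (Invertibility of each `α s` is automatic,
as `α` is a homomorphism from a group into the monoid of bounded operators on `A`.) -/
structure DynamicalSystem (𝕜 : Type*) [RCLike 𝕜] (A : Type*) [NonUnitalNormedRing A]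
    [NormedSpace 𝕜 A] (G : Type*) [Group G] [TopologicalSpace G] where
  /-- the action of the group -/
  α : G →* (A →L[𝕜] A)
  map_mul : ∀ s a b, α s (a * b) = α s a * α s b
  continuous_α : ∀ a, Continuous fun s => α s a

/-- `A` has a bounded approximate left identity (a bounded net `u` with `u a → a` for all `a`; a net
enters only through the filter of its tails). -/
def HasBoundedApproxLeftIdentity (A : Type*) [NonUnitalNormedRing A] : Prop :=
  ∃ l : Filter A, l.NeBot ∧ (∃ M : ℝ, ∀ᶠ u in l, ‖u‖ ≤ M) ∧ ∀ a, Tendsto (fun u => u * a) l (𝓝 a)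

section

universe w

variable {𝕜 : Type*} [RCLike 𝕜] {A : Type*} [NonUnitalNormedRing A] [NormedSpace 𝕜 A]
  {G : Type*} [Group G] [TopologicalSpace G]

/-- A continuous covariant representation `(π, U)` of `(A, G, α)` on a Banach space `X`: `π` is
a norm-bounded representation of the algebra, `U` a strongly continuous representation of the group,
and `π (α s a) = U s π(a) (U s)⁻¹`. -/
structure ContCovRep (𝔖 : DynamicalSystem 𝕜 A G) where
  /-- the Banach space -/
  X : Type w
  [instNormedAddCommGroup : NormedAddCommGroup X]
  [instNormedSpace : NormedSpace 𝕜 X]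
  [instCompleteSpace : CompleteSpace X]
  /-- the representation of the algebra -/
  π : A →L[𝕜] (X →L[𝕜] X)
  π_mul : ∀ a b, π (a * b) = π a * π b
  /-- the representation of the group -/
  U : G →* (X →L[𝕜] X)
  continuous_U : ∀ x, Continuous fun s => U s x
  covariant : ∀ s a, π (𝔖.α s a) = U s * π a * U s⁻¹

attribute [instance] ContCovRep.instNormedAddCommGroup ContCovRep.instNormedSpace
  ContCovRep.instCompleteSpace

/-- `(π, U)` is non-degenerate: the linear span of `π(A) X` is dense in `X`. -/
def ContCovRep.IsNondegenerate {𝔖 : DynamicalSystem 𝕜 A G} (ρ : ContCovRep.{w} 𝔖) : Prop :=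
  Dense (Submodule.span 𝕜 {y : ρ.X | ∃ a x, y = ρ.π a x} : Set ρ.X)

/-- A (non-empty) uniformly bounded class of continuous covariant representations. -/
structure UniformlyBoundedClass (𝔖 : DynamicalSystem 𝕜 A G) where
  /-- the members of the class -/
  carrier : Set (ContCovRep.{w} 𝔖)
  nonempty : carrier.Nonempty
  bounded : ∃ (C : ℝ) (ν : G → ℝ), 0 ≤ C ∧ (∀ r, 0 ≤ ν r) ∧
    (∀ K : Set G, IsCompact K → BddAbove (ν '' K)) ∧
    ∀ ρ ∈ carrier, ‖ρ.π‖ ≤ C ∧ ∀ r, ‖ρ.U r‖ ≤ ν r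

end

/-! ### Twisted convolution, integrated forms, the seminorm -/

section

open scoped Pointwise

universe w

variable {𝕜 : Type*} [RCLike 𝕜] {A : Type*} [NonUnitalNormedRing A] [NormedSpace 𝕜 A]
  [IsScalarTower 𝕜 A A] [SMulCommClass 𝕜 A A] [CompleteSpace A]
  {G : Type*} [Group G] [TopologicalSpace G] [IsTopologicalGroup G] [LocallyCompactSpace G]
  [T2Space G] [MeasurableSpace G] [BorelSpace G]
  (μ : Measure G) [μ.IsHaarMeasure] (𝔖 : DynamicalSystem 𝕜 A G)

theorem continuous_convIntegrand (f g : C_c(G, A)) :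
    Continuous (fun p : G × G => f p.2 * 𝔖.α p.2 (g (p.2⁻¹ * p.1))) := by
  have h := continuous_uncurry_of_strong 𝔖.continuous_α
  have h2 : Continuous fun p : G × G => (p.2, g (p.2⁻¹ * p.1)) :=
    continuous_snd.prodMk (g.continuous.comp (by fun_prop))
  exact (f.continuous.comp continuous_snd).mul (h.comp h2)

/-- Twisted convolution `[f * g](s) = ∫ f(r) α_r(g(r⁻¹ s)) dr` on `C_c(G, A)`. -/
def twistedConv (f g : C_c(G, A)) : C_c(G, A) where
  toFun s := integralK 𝕜 μ fun r => f r * 𝔖.α r (g (r⁻¹ * s))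
  continuous_toFun := continuous_integralK (f := fun s r => f r * 𝔖.α r (g (r⁻¹ * s)))
    f.hasCompactSupport (continuous_convIntegrand 𝔖 f g)
    (fun x y hy => by simp [image_eq_zero_of_notMem_tsupport hy])
  hasCompactSupport' := by
    refine HasCompactSupport.intro (K := tsupport f * tsupport g)
      (f.hasCompactSupport.isCompact.mul g.hasCompactSupport.isCompact) fun s hs => ?_
    have : (fun r => f r * 𝔖.α r (g (r⁻¹ * s))) = fun _ => (0 : 𝕜) • (0 : A) := by
      funext r
      by_cases hr : r ∈ tsupport f
      · have : r⁻¹ * s ∉ tsupport g := fun h => hs ⟨r, hr, r⁻¹ * s, h, by simp⟩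
        simp [image_eq_zero_of_notMem_tsupport this]
      · simp [image_eq_zero_of_notMem_tsupport hr]
    rw [this, integralK_smul, zero_smul]

theorem continuous_convIntegrand' (f g : C_c(G, A)) (s : G) :
    Continuous fun r => f r * 𝔖.α r (g (r⁻¹ * s)) :=
  (continuous_convIntegrand 𝔖 f g).comp (continuous_const.prodMk continuous_id)

theorem hasCompactSupport_convIntegrand (f g : C_c(G, A)) (s : G) :
    HasCompactSupport fun r => f r * 𝔖.α r (g (r⁻¹ * s)) :=
  f.hasCompactSupport.mul_right

variable {𝔖}

theorem ContCovRep.continuous_integrand (ρ : ContCovRep.{w} 𝔖) (f : C_c(G, A)) (x : ρ.X) :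
    Continuous fun s => ρ.π (f s) (ρ.U s x) :=
  (ρ.π.continuous.comp f.continuous).clm_apply (ρ.continuous_U x)

theorem ContCovRep.hasCompactSupport_integrand (ρ : ContCovRep.{w} 𝔖) (f : C_c(G, A)) (x : ρ.X) :
    HasCompactSupport fun s => ρ.π (f s) (ρ.U s x) := by
  refine HasCompactSupport.intro f.hasCompactSupport fun s hs => ?_
  simp [image_eq_zero_of_notMem_tsupport hs]

theorem ContCovRep.norm_integrated_le (ρ : ContCovRep.{w} 𝔖) (f : C_c(G, A)) {M C : ℝ}
    (hC : ‖ρ.π‖ ≤ C) (hM : ∀ s ∈ tsupport f, ‖ρ.U s‖ ≤ M) (x : ρ.X) :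
    ‖integralK 𝕜 μ fun s => ρ.π (f s) (ρ.U s x)‖ ≤ (C * M * ∫ s, ‖f s‖ ∂μ) * ‖x‖ := by
  have hb : Continuous fun s => C * M * ‖f s‖ * ‖x‖ := by
    have := f.continuous
    fun_prop
  have hb' : HasCompactSupport fun s => C * M * ‖f s‖ * ‖x‖ := by
    refine HasCompactSupport.intro f.hasCompactSupport fun s hs => ?_
    simp [image_eq_zero_of_notMem_tsupport hs]
  refine (norm_integralK_le (μ := μ) (𝕜 := 𝕜) hb hb' fun s => ?_).trans_eq ?_
  · by_cases hs : s ∈ tsupport f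
    · have h0 : 0 ≤ C := (norm_nonneg ρ.π).trans hC
      calc ‖ρ.π (f s) (ρ.U s x)‖ ≤ ‖ρ.π (f s)‖ * ‖ρ.U s x‖ := (ρ.π (f s)).le_opNorm _
        _ ≤ (C * ‖f s‖) * (M * ‖x‖) := by
          gcongr
          · exact ρ.π.le_of_opNorm_le hC _
          · exact (ρ.U s).le_of_opNorm_le (hM s hs) _
        _ = _ := by ring
    · simp [image_eq_zero_of_notMem_tsupport hs]
  · rw [integral_mul_const, integral_const_mul]

/-- The integrated form `π ⋊ U` of `(π, U)`: `(π ⋊ U)(f) x = ∫ π(f(s)) U_s x ds`. -/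
def ContCovRep.integratedForm (ρ : ContCovRep.{w} 𝔖) : C_c(G, A) →ₗ[𝕜] (ρ.X →L[𝕜] ρ.X) where
  toFun f := LinearMap.mkContinuousOfExistsBound
    { toFun := fun x => integralK 𝕜 μ fun s => ρ.π (f s) (ρ.U s x)
      map_add' := fun x y => by
        simp only [map_add]
        exact integralK_add (ρ.continuous_integrand f x) (ρ.hasCompactSupport_integrand f x)
          (ρ.continuous_integrand f y) (ρ.hasCompactSupport_integrand f y)
      map_smul' := fun c x => by
        simp only [map_smul, RingHom.id_apply]
        exact integralK_smul c _ }
    (by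
      obtain ⟨M, hM⟩ := exists_norm_le_on_compact ρ.continuous_U f.hasCompactSupport.isCompact
      exact ⟨_, fun x => ρ.norm_integrated_le μ f le_rfl hM x⟩)
  map_add' f g := by
    ext x
    have := integralK_add (𝕜 := 𝕜) (μ := μ) (ρ.continuous_integrand f x)
      (ρ.hasCompactSupport_integrand f x) (ρ.continuous_integrand g x)
      (ρ.hasCompactSupport_integrand g x)
    simpa [LinearMap.mkContinuousOfExistsBound] using this
  map_smul' c f := by
    ext x
    have := integralK_smul (𝕜 := 𝕜) (μ := μ) c (fun s => ρ.π (f s) (ρ.U s x))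
    simpa [LinearMap.mkContinuousOfExistsBound] using this

theorem ContCovRep.integratedForm_apply (ρ : ContCovRep.{w} 𝔖) (f : C_c(G, A)) (x : ρ.X) :
    ρ.integratedForm μ f x = integralK 𝕜 μ fun s => ρ.π (f s) (ρ.U s x) := rfl

/-- The integrated form is multiplicative for twisted convolution. -/
theorem ContCovRep.integratedForm_conv (ρ : ContCovRep.{w} 𝔖) (f g : C_c(G, A)) :
    ρ.integratedForm μ (twistedConv μ 𝔖 f g) = ρ.integratedForm μ f * ρ.integratedForm μ g := by
  ext x
  have hU := continuous_uncurry_of_strong ρ.continuous_U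
  have hcov : ∀ r a y, ρ.π (𝔖.α r a) y = ρ.U r (ρ.π a (ρ.U r⁻¹ y)) := fun r a y => by
    rw [ρ.covariant]; rfl
  have hmul : ∀ r s y, ρ.U (r * s) y = ρ.U r (ρ.U s y) := fun r s y => by rw [map_mul]; rfl
  let F : G → G → ρ.X := fun s r => ρ.π (f r) (ρ.U r (ρ.π (g (r⁻¹ * s)) (ρ.U (r⁻¹ * s) x)))
  have hg : Continuous fun p : G × G => ρ.π (g (p.2⁻¹ * p.1)) (ρ.U (p.2⁻¹ * p.1) x) :=
    (ρ.continuous_integrand g x).comp (by fun_prop : Continuous fun p : G × G => p.2⁻¹ * p.1)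
  have hF : Continuous F.uncurry := by
    have h1 : Continuous fun p : G × G =>
        ρ.U p.2 (ρ.π (g (p.2⁻¹ * p.1)) (ρ.U (p.2⁻¹ * p.1) x)) :=
      hU.comp (continuous_snd.prodMk hg)
    exact (ρ.π.continuous.comp (f.continuous.comp continuous_snd)).clm_apply h1
  have hF' : HasCompactSupport F.uncurry := by
    refine HasCompactSupport.intro (K := (tsupport f * tsupport g) ×ˢ tsupport f)
      ((f.hasCompactSupport.isCompact.mul g.hasCompactSupport.isCompact).prod
        f.hasCompactSupport.isCompact) ?_
    rintro ⟨s, r⟩ hp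
    by_cases hr : r ∈ tsupport f
    · have : r⁻¹ * s ∉ tsupport g := fun h => hp ⟨⟨r, hr, r⁻¹ * s, h, by simp⟩, hr⟩
      simp [F, image_eq_zero_of_notMem_tsupport this]
    · simp [F, image_eq_zero_of_notMem_tsupport hr]
  have e1 : ∀ s, ρ.π (twistedConv μ 𝔖 f g s) (ρ.U s x) = integralK 𝕜 μ fun r => F s r := by
    intro s
    have := integralK_clm (μ := μ) ((ContinuousLinearMap.apply 𝕜 ρ.X (ρ.U s x)).comp ρ.π)
      (continuous_convIntegrand' 𝔖 f g s) (hasCompactSupport_convIntegrand 𝔖 f g s)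
    refine Eq.trans this.symm ?_
    congr 1
    funext r
    change ρ.π (f r * 𝔖.α r (g (r⁻¹ * s))) (ρ.U s x) = _
    rw [ρ.π_mul]
    change ρ.π (f r) (ρ.π (𝔖.α r (g (r⁻¹ * s))) (ρ.U s x)) = _
    rw [hcov, ← hmul]
  have e2 : ∀ r, integralK 𝕜 μ (fun s => F s r) = ρ.π (f r) (ρ.U r (ρ.integratedForm μ g x)) := by
    intro r
    have h1 := integralK_mul_left (𝕜 := 𝕜) (μ := μ)
      (fun s => ρ.π (f r) (ρ.U r (ρ.π (g s) (ρ.U s x)))) r⁻¹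
    refine Eq.trans h1 ?_
    exact integralK_clm (μ := μ) ((ρ.π (f r)).comp (ρ.U r))
      (ρ.continuous_integrand g x) (ρ.hasCompactSupport_integrand g x)
  change integralK 𝕜 μ (fun s => ρ.π (twistedConv μ 𝔖 f g s) (ρ.U s x)) =
    integralK 𝕜 μ (fun r => ρ.π (f r) (ρ.U r (ρ.integratedForm μ g x)))
  simp only [e1, ← e2]
  exact integralK_swap hF hF'

variable (R : UniformlyBoundedClass.{w} 𝔖)

theorem bddAbove_norm_integratedForm (f : C_c(G, A)) :
    BddAbove (range fun ρ : R.carrier => ‖ρ.1.integratedForm μ f‖) := by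
  obtain ⟨C, ν, hC, hν, hK, hR⟩ := R.bounded
  obtain ⟨M, hM⟩ := hK _ f.hasCompactSupport.isCompact
  refine ⟨C * max M 0 * ∫ s, ‖f s‖ ∂μ, ?_⟩
  rintro _ ⟨ρ, rfl⟩
  refine ContinuousLinearMap.opNorm_le_bound _ (by positivity) fun x => ?_
  exact ρ.1.norm_integrated_le μ f (hR ρ.1 ρ.2).1 (fun s hs =>
    (((hR ρ.1 ρ.2).2 s).trans (hM ⟨s, hs, rfl⟩)).trans (le_max_left _ _)) x

/-- The seminorm `σ^R(f) = sup_{(π, U) ∈ R} ‖(π ⋊ U)(f)‖` on `C_c(G, A)`. -/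
def sigma : Seminorm 𝕜 C_c(G, A) :=
  Seminorm.of (fun f => ⨆ ρ : R.carrier, ‖ρ.1.integratedForm μ f‖)
    (fun f g => by
      have : Nonempty R.carrier := R.nonempty.to_subtype
      refine ciSup_le fun ρ => ?_
      rw [map_add]
      exact (norm_add_le _ _).trans (add_le_add
        (le_ciSup (bddAbove_norm_integratedForm μ R f) ρ)
        (le_ciSup (bddAbove_norm_integratedForm μ R g) ρ)))
    (fun c f => by
      simp only [map_smul, norm_smul]
      exact (Real.mul_iSup_of_nonneg (norm_nonneg c) _).symm)

theorem sigma_apply (f : C_c(G, A)) :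
    sigma μ R f = ⨆ ρ : R.carrier, ‖ρ.1.integratedForm μ f‖ := rfl

theorem sigma_conv_le (f g : C_c(G, A)) :
    sigma μ R (twistedConv μ 𝔖 f g) ≤ sigma μ R f * sigma μ R g := by
  have : Nonempty R.carrier := R.nonempty.to_subtype
  refine ciSup_le fun ρ => ?_
  rw [ρ.1.integratedForm_conv μ]
  exact (norm_mul_le _ _).trans (mul_le_mul (le_ciSup (bddAbove_norm_integratedForm μ R f) ρ)
    (le_ciSup (bddAbove_norm_integratedForm μ R g) ρ) (norm_nonneg _) (apply_nonneg _ _))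

theorem sigma_eq_zero {f : C_c(G, A)} (hf : ∀ ρ ∈ R.carrier, ρ.integratedForm μ f = 0) :
    sigma μ R f = 0 := by
  have : Nonempty R.carrier := R.nonempty.to_subtype
  rw [sigma_apply]
  simp [fun ρ : R.carrier => hf ρ.1 ρ.2]

/-! ### The crossed product -/

/-- `C_c(G, A)` equipped with the seminorm `σ^R`. -/
def PreCrossedProduct (_μ : Measure G) (_R : UniformlyBoundedClass.{w} 𝔖) : Type _ := C_c(G, A)

instance : AddCommGroup (PreCrossedProduct μ R) := inferInstanceAs (AddCommGroup C_c(G, A))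

instance : Module 𝕜 (PreCrossedProduct μ R) := inferInstanceAs (Module 𝕜 C_c(G, A))

instance : SeminormedAddCommGroup (PreCrossedProduct μ R) :=
  AddGroupSeminorm.toSeminormedAddCommGroup
    (E := PreCrossedProduct μ R) (sigma μ R).toAddGroupSeminorm

theorem PreCrossedProduct.norm_def (f : PreCrossedProduct μ R) : ‖f‖ = sigma μ R f := rfl

instance : NormedSpace 𝕜 (PreCrossedProduct μ R) where
  norm_smul_le c f := (map_smul_eq_mul (sigma μ R) c f).le

/-- Twisted convolution as a bounded bilinear map for `σ^R`. -/
def PreCrossedProduct.conv :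
    PreCrossedProduct μ R →L[𝕜] PreCrossedProduct μ R →L[𝕜] PreCrossedProduct μ R :=
  LinearMap.mkContinuous₂
    (LinearMap.mk₂ 𝕜 (fun f g : PreCrossedProduct μ R =>
        (twistedConv μ 𝔖 f g : PreCrossedProduct μ R))
      (fun f f' g => by
        refine CompactlySupportedContinuousMap.ext fun s => ?_
        refine Eq.trans ?_ (integralK_add (𝕜 := 𝕜) (μ := μ) (continuous_convIntegrand' 𝔖 f g s)
          (hasCompactSupport_convIntegrand 𝔖 f g s) (continuous_convIntegrand' 𝔖 f' g s)
          (hasCompactSupport_convIntegrand 𝔖 f' g s))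
        exact congrArg (integralK 𝕜 μ) (funext fun r => add_mul _ _ _))
      (fun c f g => by
        refine CompactlySupportedContinuousMap.ext fun s => ?_
        refine Eq.trans ?_ (integralK_smul (𝕜 := 𝕜) (μ := μ) c _)
        exact congrArg (integralK 𝕜 μ) (funext fun r => smul_mul_assoc _ _ _))
      (fun f g g' => by
        refine CompactlySupportedContinuousMap.ext fun s => ?_
        refine Eq.trans ?_ (integralK_add (𝕜 := 𝕜) (μ := μ) (continuous_convIntegrand' 𝔖 f g s)
          (hasCompactSupport_convIntegrand 𝔖 f g s) (continuous_convIntegrand' 𝔖 f g' s)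
          (hasCompactSupport_convIntegrand 𝔖 f g' s))
        refine congrArg (integralK 𝕜 μ) (funext fun r => ?_)
        rw [← mul_add, ← map_add]
        rfl)
      (fun c f g => by
        refine CompactlySupportedContinuousMap.ext fun s => ?_
        refine Eq.trans ?_ (integralK_smul (𝕜 := 𝕜) (μ := μ) c _)
        refine congrArg (integralK 𝕜 μ) (funext fun r => ?_)
        rw [← mul_smul_comm, ← map_smul]
        rfl))
    1 (fun f g => by rw [one_mul]; exact sigma_conv_le μ R f g)

/-- The crossed product `(A ⋊_α G)^R`: the completion of `C_c(G, A) / ker σ^R`, where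
`UniformSpace.Completion` performs the passage to the quotient by the kernel of the seminorm. -/
def CrossedProduct (μ : Measure G) [μ.IsHaarMeasure] (R : UniformlyBoundedClass.{w} 𝔖) : Type _ :=
  UniformSpace.Completion (PreCrossedProduct μ R)

namespace CrossedProduct

instance : NormedAddCommGroup (CrossedProduct μ R) :=
  inferInstanceAs (NormedAddCommGroup (UniformSpace.Completion (PreCrossedProduct μ R)))

instance : NormedSpace 𝕜 (CrossedProduct μ R) :=
  inferInstanceAs (NormedSpace 𝕜 (UniformSpace.Completion (PreCrossedProduct μ R)))

instance : CompleteSpace (CrossedProduct μ R) :=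
  inferInstanceAs (CompleteSpace (UniformSpace.Completion (PreCrossedProduct μ R)))

/-- The quotient map `q^R : C_c(G, A) → (A ⋊_α G)^R`. -/
def q : PreCrossedProduct μ R →L[𝕜] CrossedProduct μ R :=
  (UniformSpace.Completion.toComplL :
    PreCrossedProduct μ R →L[𝕜] UniformSpace.Completion (PreCrossedProduct μ R))

theorem norm_q (f : PreCrossedProduct μ R) : ‖q μ R f‖ = sigma μ R f :=
  UniformSpace.Completion.norm_coe f

theorem denseRange_q : DenseRange (q μ R) := UniformSpace.Completion.denseRange_coe

theorem isUniformInducing_q : IsUniformInducing (q μ R) :=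
  UniformSpace.Completion.isUniformInducing_coe _

/-- The product of the crossed product: the continuous bilinear extension of
`(q f, q g) ↦ q (f * g)`. -/
def mulL : CrossedProduct μ R →L[𝕜] CrossedProduct μ R →L[𝕜] CrossedProduct μ R :=
  let c : PreCrossedProduct μ R →L[𝕜] PreCrossedProduct μ R →L[𝕜] CrossedProduct μ R :=
    (ContinuousLinearMap.compL 𝕜 _ _ _ (q μ R)).comp (PreCrossedProduct.conv μ R)
  let c₁ : CrossedProduct μ R →L[𝕜] PreCrossedProduct μ R →L[𝕜] CrossedProduct μ R :=
    c.extend (q μ R)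
  (c₁.flip.extend (q μ R)).flip

theorem mulL_q (f g : PreCrossedProduct μ R) :
    mulL μ R (q μ R f) (q μ R g) = q μ R (PreCrossedProduct.conv μ R f g) := by
  unfold mulL
  simp only [ContinuousLinearMap.flip_apply,
    ContinuousLinearMap.extend_eq _ (denseRange_q μ R) (isUniformInducing_q μ R)]
  rfl

theorem norm_mulL_le (a b : CrossedProduct μ R) : ‖mulL μ R a b‖ ≤ ‖a‖ * ‖b‖ := by
  refine (denseRange_q μ R).induction_on₂ (p := fun a b => ‖mulL μ R a b‖ ≤ ‖a‖ * ‖b‖)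
    (isClosed_le (by fun_prop) (by fun_prop)) (fun f g => ?_) a b
  rw [mulL_q, norm_q, norm_q, norm_q]
  exact sigma_conv_le μ R f g

theorem mulL_assoc (a b c : CrossedProduct μ R) :
    mulL μ R (mulL μ R a b) c = mulL μ R a (mulL μ R b c) := by
  refine (denseRange_q μ R).induction_on₃
    (p := fun a b c => mulL μ R (mulL μ R a b) c = mulL μ R a (mulL μ R b c))
    (isClosed_eq (by fun_prop) (by fun_prop)) (fun f g h => ?_) a b c
  rw [mulL_q, mulL_q, mulL_q, mulL_q, ← sub_eq_zero, ← map_sub, ← norm_eq_zero, norm_q]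
  refine sigma_eq_zero μ R fun ρ _ => ?_
  have key : ∀ f g h : C_c(G, A), ρ.integratedForm μ (twistedConv μ 𝔖 (twistedConv μ 𝔖 f g) h) -
      ρ.integratedForm μ (twistedConv μ 𝔖 f (twistedConv μ 𝔖 g h)) = 0 := fun f g h => by
    simp only [ρ.integratedForm_conv μ, mul_assoc, sub_self]
  exact (map_sub (ρ.integratedForm μ) (twistedConv μ 𝔖 (twistedConv μ 𝔖 f g) h)
    (twistedConv μ 𝔖 f (twistedConv μ 𝔖 g h))).trans (key f g h)

instance : NonUnitalNormedRing (CrossedProduct μ R) :=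
  { (inferInstance : NormedAddCommGroup (CrossedProduct μ R)) with
    mul := fun a b => mulL μ R a b
    left_distrib := fun a b c => map_add (mulL μ R a) b c
    right_distrib := fun a b c => (mulL μ R).map_add₂ a b c
    zero_mul := fun a => (mulL μ R).map_zero₂ a
    mul_zero := fun a => map_zero (mulL μ R a)
    mul_assoc := mulL_assoc μ R
    norm_mul_le := norm_mulL_le μ R }

theorem mul_def (a b : CrossedProduct μ R) : a * b = mulL μ R a b := rfl

instance : IsScalarTower 𝕜 (CrossedProduct μ R) (CrossedProduct μ R) where
  smul_assoc c a b := (mulL μ R).map_smul₂ c a b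

instance : SMulCommClass 𝕜 (CrossedProduct μ R) (CrossedProduct μ R) where
  smul_comm c a b := (map_smul (mulL μ R a) c b).symm

/-- `q^R` is multiplicative. -/
theorem q_mul (f g : C_c(G, A)) :
    q μ R (twistedConv μ 𝔖 f g : C_c(G, A)) = q μ R f * q μ R g := (mulL_q μ R f g).symm

end CrossedProduct

end

/-! ### The left centralizer algebra and the left regular representation -/

section LeftCentralizer

variable (𝕜 : Type*) [RCLike 𝕜] (B : Type*) [NonUnitalNormedRing B] [NormedSpace 𝕜 B]
  [IsScalarTower 𝕜 B B] [SMulCommClass 𝕜 B B]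

/-- The left centralizer algebra `M_l(B)`: all bounded operators `L` on `B` with
`L (a b) = (L a) b`, with the operator norm. -/
def leftCentralizer : Subalgebra 𝕜 (B →L[𝕜] B) where
  carrier := {L | ∀ a b, L (a * b) = L a * b}
  mul_mem' {L L'} h h' a b := by
    change L (L' (a * b)) = L (L' a) * b
    rw [h', h]
  add_mem' {L L'} h h' a b := by
    change L (a * b) + L' (a * b) = (L a + L' a) * b
    rw [h, h', add_mul]
  algebraMap_mem' c a b := by
    change c • (a * b) = (c • a) * b
    rw [smul_mul_assoc]

/-- The left regular representation `λ : B → M_l(B)`, `λ(a) b = a b`. -/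
def leftRegular : B →ₙₐ[𝕜] leftCentralizer 𝕜 B where
  toFun a := ⟨ContinuousLinearMap.mul 𝕜 B a, fun b c => (mul_assoc a b c).symm⟩
  map_smul' c a := Subtype.ext (map_smul (ContinuousLinearMap.mul 𝕜 B) c a)
  map_zero' := Subtype.ext (map_zero (ContinuousLinearMap.mul 𝕜 B))
  map_add' a b := Subtype.ext (map_add (ContinuousLinearMap.mul 𝕜 B) a b)
  map_mul' a b := Subtype.ext (ContinuousLinearMap.ext fun c => mul_assoc a b c)

end LeftCentralizer

end BanachCrossedProduct

end

/-! Continuity of the left regular representation is submultiplicativity of the norm, so the content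
is a lower bound `‖b‖ ≤ L * ‖λ(b)‖`. By density it suffices to take `b = q f`, whose norm is the
supremum of `‖ρ(f)‖` over the integrated forms `ρ` of the class.

For a fixed `ρ` and vector `x`, suppose `u` in `C_c(G, A)` satisfies `σ(u) ≤ L` and `ρ(u) x ≈ x`.
Then `ρ(f) x ≈ ρ(f) ρ(u) x = ρ(f * u) x`, and `‖ρ(f * u) x‖ ≤ σ(f * u) ‖x‖ ≤ L ‖λ(q f)‖ ‖x‖`. The
function `u` may depend on `ρ` and `x`; only the bound `L` must not. Hence no approximate right
identity of the crossed product is needed: `u` multiplies `f` on the right, but it acts on `x` from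
the left, where a left identity of `A` suffices.

Such a `u` is `z ⊗ a`. Non-degeneracy gives an `a` from the bounded approximate left identity with
`π(a) x ≈ x`, and `z` is a bump of integral `1` concentrated near the identity of `G`, where `U_s x
≈ x`. This is `exists_sigma_bounded_approx_identity`; the lower bound is
`CrossedProduct.exists_norm_le_mul_norm_mulL`. -/

namespace BanachCrossedProduct

/-! ### Normalized bump functions at the identity of the group -/

section BumpFunction

variable {G : Type*} [Group G] [TopologicalSpace G] [IsTopologicalGroup G] [LocallyCompactSpace G]
  [T2Space G] [MeasurableSpace G] [BorelSpace G] (μ : Measure G) [μ.IsHaarMeasure]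

/-- Every neighbourhood of `1` supports a non-negative continuous function of integral `1` with
compact support. -/
theorem exists_continuous_integral_eq_one {V : Set G} (hV : V ∈ 𝓝 (1 : G)) :
    ∃ z : G → ℝ, Continuous z ∧ HasCompactSupport z ∧ tsupport z ⊆ V ∧ (∀ s, 0 ≤ z s) ∧
      ∫ s, z s ∂μ = 1 := by
  obtain ⟨f, hf1, hfc, hfV, hf01⟩ := exists_continuousMap_one_of_isCompact_subset_isOpen
    isCompact_singleton isOpen_interior (singleton_subset_iff.2 (mem_interior_iff_mem_nhds.2 hV))
  -- Haar measure is positive on non-empty open sets, and `f 1 = 1`.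
  have hpos : 0 < ∫ s, f s ∂μ :=
    f.continuous.integral_pos_of_hasCompactSupport_nonneg_nonzero hfc (fun s => (hf01 s).1)
      (x := 1) (by simp [hf1 rfl])
  refine ⟨fun s => (∫ s, f s ∂μ)⁻¹ * f s, by fun_prop, HasCompactSupport.mul_left hfc, ?_, fun s => ?_, ?_⟩
  · exact (closure_mono (Function.support_mul_subset_right _ _)).trans (hfV.trans interior_subset)
  · exact mul_nonneg (inv_nonneg.2 hpos.le) (hf01 s).1
  · rw [integral_const_mul, inv_mul_cancel₀ hpos.ne']

end BumpFunction

/-! ### Approximate left identities in non-degenerate representations -/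

section

universe w

variable {𝕜 : Type*} [RCLike 𝕜] {A : Type*} [NonUnitalNormedRing A] [NormedSpace 𝕜 A]
  {G : Type*} [Group G] [TopologicalSpace G]

/-- A bounded approximate left identity acts as an approximate identity in every non-degenerate
representation. -/
theorem ContCovRep.tendsto_π_apply {𝔖 : DynamicalSystem 𝕜 A G} {ρ : ContCovRep.{w} 𝔖}
    (hρ : ρ.IsNondegenerate) {l : Filter A} {M : ℝ} (hM : ∀ᶠ u in l, ‖u‖ ≤ M)
    (hl : ∀ a, Tendsto (fun u => u * a) l (𝓝 a)) (x : ρ.X) :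
    Tendsto (fun u => ρ.π u x) l (𝓝 x) := by
  -- On generators, `π(u) π(a) x = π(u a) x → π(a) x`; the eventual uniform bound on `‖π(u)‖` then
  -- carries convergence from the span to its closure.
  have hspan : ∀ y ∈ Submodule.span 𝕜 {y : ρ.X | ∃ a x, y = ρ.π a x},
      Tendsto (fun u => ρ.π u y) l (𝓝 y) := fun y hy => by
    induction hy using Submodule.span_induction with
    | mem y hy =>
      obtain ⟨a, x, rfl⟩ := hy
      have h := ((ContinuousLinearMap.apply 𝕜 ρ.X x).comp ρ.π).continuous.continuousAt.tendsto.comp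
        (hl a)
      refine h.congr fun u => ?_
      change ρ.π (u * a) x = _
      rw [ρ.π_mul]
      rfl
    | zero => simpa using tendsto_const_nhds
    | add y y' _ _ h h' => simpa using h.add h'
    | smul c y _ h => simpa using h.const_smul c
  -- `B - 1` eventually bounds `‖π(u)‖`, and the extra `1` pays for the term `x - y`, so both errors
  -- together cost at most `B * ‖x - y‖ < ε / 3`. Since `l` may be trivial here, `M` can be
  -- negative, hence `max M 0`.
  set B : ℝ := ‖ρ.π‖ * max M 0 + 1
  have hB : 1 ≤ B := le_add_of_nonneg_left (by positivity)
  refine Metric.tendsto_nhds.2 fun ε hε => ?_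
  obtain ⟨y, hy, hxy⟩ := Metric.dense_iff.1 hρ x (ε / (3 * B)) (by positivity)
  rw [Metric.mem_ball, dist_comm, dist_eq_norm, lt_div_iff₀ (by positivity)] at hy
  filter_upwards [hM, Metric.tendsto_nhds.1 (hspan y hxy) (ε / 3) (by positivity)] with u hu huy
  rw [dist_eq_norm] at huy ⊢
  have h1 : ‖ρ.π u (x - y)‖ ≤ (B - 1) * ‖x - y‖ := by
    refine (ρ.π u).le_of_opNorm_le ((ρ.π.le_opNorm u).trans ?_) _
    rw [add_sub_cancel_right]
    gcongr
    exact hu.trans (le_max_left _ _)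
  have h2 : ρ.π u x - x = ρ.π u (x - y) + (ρ.π u y - y) - (x - y) := by
    rw [map_sub]; abel
  rw [h2]
  calc _ ≤ ‖ρ.π u (x - y)‖ + ‖ρ.π u y - y‖ + ‖x - y‖ :=
        (norm_sub_le _ _).trans (add_le_add_left (norm_add_le _ _) _)
    _ < ε := by nlinarith

end

/-! ### Elementary functions, approximate units and the lower bound -/

section

universe w

variable {𝕜 : Type*} [RCLike 𝕜] {A : Type*} [NonUnitalNormedRing A] [NormedSpace 𝕜 A]
  [IsScalarTower 𝕜 A A] [SMulCommClass 𝕜 A A] [CompleteSpace A]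
  {G : Type*} [Group G] [TopologicalSpace G] [IsTopologicalGroup G] [LocallyCompactSpace G]
  [T2Space G] [MeasurableSpace G] [BorelSpace G]
  (μ : Measure G) [μ.IsHaarMeasure] {𝔖 : DynamicalSystem 𝕜 A G}

/-- The elementary function `s ↦ z(s) a` of `C_c(G, A)`. -/
def elementary (𝕜 : Type*) [RCLike 𝕜] [NormedSpace 𝕜 A] {z : G → ℝ} (hz : Continuous z)
    (hz' : HasCompactSupport z) (a : A) : C_c(G, A) where
  toFun s := (z s : 𝕜) • a
  continuous_toFun := by fun_prop
  hasCompactSupport' := by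
    refine HasCompactSupport.intro hz' fun s hs => ?_
    simp [image_eq_zero_of_notMem_tsupport hs]

theorem elementary_apply {z : G → ℝ} (hz : Continuous z) (hz' : HasCompactSupport z) (a : A)
    (s : G) : elementary 𝕜 hz hz' a s = (z s : 𝕜) • a := rfl

theorem tsupport_elementary_subset {z : G → ℝ} (hz : Continuous z) (hz' : HasCompactSupport z)
    (a : A) : tsupport (elementary 𝕜 hz hz' a) ⊆ tsupport z :=
  closure_mono fun s hs h => hs (by simp [elementary_apply, h])

/-- Once `z` is normalized, the `L¹` norm no longer sees how concentrated `z` is; this keeps the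
bound on `σ` uniform as the support shrinks. -/
theorem integral_norm_elementary {z : G → ℝ} (hz : Continuous z) (hz' : HasCompactSupport z)
    (h0 : ∀ s, 0 ≤ z s) (a : A) :
    ∫ s, ‖elementary 𝕜 hz hz' a s‖ ∂μ = (∫ s, z s ∂μ) * ‖a‖ := by
  rw [← integral_mul_const]
  congr 1
  funext s
  rw [elementary_apply, norm_smul, RCLike.norm_ofReal, abs_of_nonneg (h0 s)]

theorem integralK_ofReal_smul_const {E : Type*} [NormedAddCommGroup E] [NormedSpace 𝕜 E]
    [CompleteSpace E] (z : G → ℝ) (y : E) :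
    integralK 𝕜 μ (fun s => (z s : 𝕜) • y) = ((∫ s, z s ∂μ : ℝ) : 𝕜) • y := by
  let _ : NormedSpace ℝ E := NormedSpace.restrictScalars ℝ 𝕜 E
  have : ∀ r : ℝ, (r : 𝕜) • y = r • y := fun _ => rfl
  simp only [this]
  exact integral_smul_const z y

/-- If `U` moves `x` little on the support of `z`, then `(π ⋊ U)(z ⊗ a) x` is close to
`π(a) x`. -/
theorem ContCovRep.norm_integratedForm_elementary_sub_le (ρ : ContCovRep.{w} 𝔖) {z : G → ℝ}
    (hz : Continuous z) (hz' : HasCompactSupport z) (h0 : ∀ s, 0 ≤ z s) (h1 : ∫ s, z s ∂μ = 1)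
    (a : A) (x : ρ.X) {δ : ℝ} (hδ : ∀ s ∈ tsupport z, ‖ρ.π a (ρ.U s x) - ρ.π a x‖ ≤ δ) :
    ‖ρ.integratedForm μ (elementary 𝕜 hz hz' a) x - ρ.π a x‖ ≤ δ := by
  have hd : Continuous fun s => (z s : 𝕜) • (ρ.π a (ρ.U s x) - ρ.π a x) := by
    have := ρ.continuous_U x
    fun_prop
  have hd' : HasCompactSupport fun s => (z s : 𝕜) • (ρ.π a (ρ.U s x) - ρ.π a x) := by
    refine HasCompactSupport.intro hz' fun s hs => ?_
    simp [image_eq_zero_of_notMem_tsupport hs]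
  have hc' : HasCompactSupport fun s => (z s : 𝕜) • ρ.π a x := by
    refine HasCompactSupport.intro hz' fun s hs => ?_
    simp [image_eq_zero_of_notMem_tsupport hs]
  have hsum := integralK_add (𝕜 := 𝕜) (μ := μ) hd hd'
    (g := fun s => (z s : 𝕜) • ρ.π a x) (by fun_prop) hc'
  -- As `z` has integral `1`, the constant `π(a) x` is itself an integral against `z`, so the
  -- difference is a `z`-average of `π(a) U_s x - π(a) x`.
  rw [integralK_ofReal_smul_const μ, h1, RCLike.ofReal_one, one_smul] at hsum
  have heq : ρ.integratedForm μ (elementary 𝕜 hz hz' a) x - ρ.π a x =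
      integralK 𝕜 μ fun s => (z s : 𝕜) • (ρ.π a (ρ.U s x) - ρ.π a x) := by
    rw [sub_eq_iff_eq_add, ← hsum, ρ.integratedForm_apply μ]
    congr 1
    funext s
    rw [elementary_apply, map_smul, smul_sub, sub_add_cancel]
    rfl
  rw [heq]
  refine (norm_integralK_le (b := fun s => z s * δ) (by fun_prop) hz'.mul_right fun s => ?_).trans
    (by rw [integral_mul_const, h1, one_mul])
  rw [norm_smul, RCLike.norm_ofReal, abs_of_nonneg (h0 s)]
  by_cases hs : s ∈ tsupport z
  · exact mul_le_mul_of_nonneg_left (hδ s hs) (h0 s)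
  · simp [image_eq_zero_of_notMem_tsupport hs]

variable (R : UniformlyBoundedClass.{w} 𝔖)

/-- There is a `σ^R`-bounded set of functions in `C_c(G, A)` whose images under each member of `R`
approximate the identity operator strongly. -/
theorem exists_sigma_bounded_approx_identity (hA : HasBoundedApproxLeftIdentity A)
    (hR : ∀ ρ ∈ R.carrier, ρ.IsNondegenerate) :
    ∃ L : ℝ, 0 ≤ L ∧ ∀ ρ ∈ R.carrier, ∀ (x : ρ.X) (ε : ℝ), 0 < ε →
      ∃ u : C_c(G, A), sigma μ R u ≤ L ∧ ‖ρ.integratedForm μ u x - x‖ < ε := by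
  obtain ⟨l, hl, ⟨M, hM⟩, hlim⟩ := hA
  obtain ⟨C, ν, hC, hν, hbdd, hb⟩ := R.bounded
  -- Fixing `K` before `ρ` and `x` gives one bound `N` for all `‖U_s‖` with `s ∈ K`; every bump
  -- below is supported in `K`.
  obtain ⟨K, hK, hK1⟩ := exists_compact_mem_nhds (1 : G)
  obtain ⟨N, hN⟩ := hbdd K hK
  have hN' : ∀ s ∈ K, ν s ≤ N := fun s hs => hN ⟨s, hs, rfl⟩
  have hN0 : 0 ≤ N := (hν 1).trans (hN' 1 (mem_of_mem_nhds hK1))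
  -- The factors bound `π`, `U` on `K`, and `a`; the bump contributes its integral `1`.
  refine ⟨C * N * max M 0, by positivity, fun ρ hρ x ε hε => ?_⟩
  obtain ⟨a, haM, hax⟩ := (hM.and (Metric.tendsto_nhds.1
    (ρ.tendsto_π_apply (hR ρ hρ) hM hlim x) (ε / 2) (half_pos hε))).exists
  have hU : Tendsto (fun s => ρ.π a (ρ.U s x)) (𝓝 1) (𝓝 (ρ.π a x)) := by
    have h := ((ρ.π a).continuous.comp (ρ.continuous_U x)).tendsto 1
    simpa [Function.comp_def] using h
  -- The bump is chosen after `a`, on a neighbourhood where `π(a) U_s x` is within `ε / 2` of `π(a)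
  -- x`.
  obtain ⟨z, hz, hz', hzV, hz0, hz1⟩ := exists_continuous_integral_eq_one μ
    (inter_mem hK1 (Metric.tendsto_nhds.1 hU (ε / 2) (half_pos hε)))
  refine ⟨elementary 𝕜 hz hz' a, ?_, ?_⟩
  -- Although `u` is adapted to `ρ` and `x`, its seminorm is estimated over every member `ρ'` of the
  -- class.
  · have : Nonempty R.carrier := R.nonempty.to_subtype
    refine ciSup_le fun ρ' => ContinuousLinearMap.opNorm_le_bound _ (by positivity) fun y => ?_
    refine (ρ'.1.norm_integrated_le μ _ (hb ρ'.1 ρ'.2).1 (M := N) (fun s hs => ?_) y).trans ?_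
    · exact ((hb ρ'.1 ρ'.2).2 s).trans
        (hN' s (hzV (tsupport_elementary_subset hz hz' a hs)).1)
    · rw [integral_norm_elementary μ hz hz' hz0, hz1, one_mul]
      gcongr
      exact haM.trans (le_max_left _ _)
  · have h1 := ρ.norm_integratedForm_elementary_sub_le μ hz hz' hz0 hz1 a x (δ := ε / 2)
      fun s hs => by
        rw [← dist_eq_norm]
        exact le_of_lt (hzV hs).2
    rw [dist_eq_norm] at hax
    calc _ = ‖(ρ.integratedForm μ (elementary 𝕜 hz hz' a) x - ρ.π a x) + (ρ.π a x - x)‖ := by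
          rw [sub_add_sub_cancel]
      _ ≤ _ := norm_add_le _ _
      _ < ε := by linarith

theorem norm_integratedForm_le_sigma {ρ : ContCovRep.{w} 𝔖} (hρ : ρ ∈ R.carrier) (f : C_c(G, A)) :
    ‖ρ.integratedForm μ f‖ ≤ sigma μ R f :=
  le_ciSup (bddAbove_norm_integratedForm μ R f) ⟨ρ, hρ⟩

/-- Left multiplication on the crossed product is bounded below. -/
theorem CrossedProduct.exists_norm_le_mul_norm_mulL (hA : HasBoundedApproxLeftIdentity A)
    (hR : ∀ ρ ∈ R.carrier, ρ.IsNondegenerate) :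
    ∃ L : ℝ, 0 ≤ L ∧ ∀ b : CrossedProduct μ R, ‖b‖ ≤ L * ‖mulL μ R b‖ := by
  obtain ⟨L, hL, h⟩ := exists_sigma_bounded_approx_identity μ R hA hR
  refine ⟨L, hL, fun b => (denseRange_q μ R).induction_on b
    (isClosed_le (by fun_prop) (by fun_prop)) fun f => ?_⟩
  rw [norm_q]
  have : Nonempty R.carrier := R.nonempty.to_subtype
  refine ciSup_le fun ⟨ρ, hρ⟩ => ContinuousLinearMap.opNorm_le_bound _ (by positivity) fun x => ?_
  set T := ρ.integratedForm μ f
  have hT : 0 < ‖T‖ + 1 := by positivity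
  refine le_of_forall_pos_le_add fun ε hε => ?_
  -- The tolerance makes the error `‖T‖ * ‖ρ(u) x - x‖` at most `ε`; the `+ 1` covers `T = 0`.
  obtain ⟨u, huL, hux⟩ := h ρ hρ x (ε / (‖T‖ + 1)) (by positivity)
  rw [lt_div_iff₀ hT] at hux
  have h1 : ‖T (ρ.integratedForm μ u x)‖ ≤ L * ‖mulL μ R (q μ R f)‖ * ‖x‖ := by
    -- The operator norm of left multiplication enters by testing it on `q u`, whose norm is at most
    -- `L`.
    have h2 : sigma μ R (twistedConv μ 𝔖 f u) ≤ L * ‖mulL μ R (q μ R f)‖ := by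
      have h3 := (mulL μ R (q μ R f)).le_opNorm (q μ R (show PreCrossedProduct μ R from u))
      rw [mulL_q, norm_q, norm_q, mul_comm] at h3
      exact h3.trans (mul_le_mul_of_nonneg_right huL (norm_nonneg _))
    have h3 := (ρ.integratedForm μ (twistedConv μ 𝔖 f u)).le_of_opNorm_le
      ((norm_integratedForm_le_sigma μ R hρ _).trans h2) x
    have h4 := ρ.integratedForm_conv μ f u
    rw [h4] at h3
    exact h3
  calc ‖T x‖ = ‖T (ρ.integratedForm μ u x) - T (ρ.integratedForm μ u x - x)‖ := by
        rw [map_sub, sub_sub_cancel]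
    _ ≤ ‖T (ρ.integratedForm μ u x)‖ + ‖T (ρ.integratedForm μ u x - x)‖ := norm_sub_le _ _
    _ ≤ L * ‖mulL μ R (q μ R f)‖ * ‖x‖ + ε := by
      refine add_le_add h1 ((T.le_opNorm _).trans ?_)
      nlinarith [norm_nonneg (ρ.integratedForm μ u x - x)]

end

/-! ### From a lower bound to an embedding -/

section LeftCentralizer

variable {𝕜 : Type*} [RCLike 𝕜] {B : Type*} [NonUnitalNormedRing B] [NormedSpace 𝕜 B]
  [IsScalarTower 𝕜 B B] [SMulCommClass 𝕜 B B]

/-- The left regular representation is an embedding as soon as it is bounded below. -/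
theorem isEmbedding_leftRegular {L : ℝ} (hL : 0 ≤ L)
    (h : ∀ b : B, ‖b‖ ≤ L * ‖ContinuousLinearMap.mul 𝕜 B b‖) :
    IsEmbedding (leftRegular 𝕜 B) := by
  have hanti : AntilipschitzWith ⟨L, hL⟩ (ContinuousLinearMap.mul 𝕜 B) :=
    AddMonoidHomClass.antilipschitz_of_bound _ h
  -- Followed by the inclusion of the left centralizers into all bounded operators, `leftRegular` is
  -- `ContinuousLinearMap.mul`, which is continuous and antilipschitz; an embedding of the composite
  -- passes to its first factor.
  exact IsEmbedding.of_comp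
    ((ContinuousLinearMap.mul 𝕜 B).continuous.subtype_mk fun a => (leftRegular 𝕜 B a).2)
    continuous_subtype_val
    (hanti.isEmbedding (ContinuousLinearMap.mul 𝕜 B).continuous)

end LeftCentralizer

end BanachCrossedProduct

theorem mainTheorem9 {𝕜 : Type*} [RCLike 𝕜]
    {A : Type*} [NonUnitalNormedRing A] [NormedSpace 𝕜 A] [IsScalarTower 𝕜 A A]
    [SMulCommClass 𝕜 A A] [CompleteSpace A]
    {G : Type*} [Group G] [TopologicalSpace G] [IsTopologicalGroup G] [LocallyCompactSpace G]
    [T2Space G] [MeasurableSpace G] [BorelSpace G] (μ : Measure G) [μ.IsHaarMeasure]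
    (𝔖 : BanachCrossedProduct.DynamicalSystem 𝕜 A G)
    (hA : BanachCrossedProduct.HasBoundedApproxLeftIdentity A)
    (R : BanachCrossedProduct.UniformlyBoundedClass 𝔖)
    (hR : ∀ ρ ∈ R.carrier, ρ.IsNondegenerate) :
    IsEmbedding (BanachCrossedProduct.leftRegular 𝕜 (BanachCrossedProduct.CrossedProduct μ R)) := by
  obtain ⟨L, hL, h⟩ := BanachCrossedProduct.CrossedProduct.exists_norm_le_mul_norm_mulL μ R hA hR
  refine BanachCrossedProduct.isEmbedding_leftRegular hL fun b => (h b).trans_eq ?_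
  -- The ring product of the crossed product is `mulL` by definition.
  rfl
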